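/- Let $\Gamma$ be a discrete abelian group with compact dual group $G$. A set $E\subseteq\Gamma$ is called a Sidon set if there is a constant $C$ such that for every bounded function $\phi:E\to\mathbb{C}$ there is a complex regular Borel measure $\mu$ on $G$ with $\widehat{\mu}(\gamma)=\int_G\overline{\gamma}\,d\mu=\phi(\gamma)$ for all $\gamma\in E$ and total variation norm $\|\mu\|_{M(G)}\le C\|\phi\|_\infty$. The least such constant $C\ge 0$ is the Sidon constant of $E$. Proposition 4.2. Suppose $\Gamma=\bigoplus_{i=1}^{\infty}\mathbb{Z}_{p_i}$, where $(p_i)_i$ is a sequence of prime numbers tending to infinity. If $E\subseteq\Gamma$ is a Sidon set, then for every $\varepsilon>0$ there is some $\delta>0$ such that every finite set $F\subseteq E$ contains a subset $H\subseteq F$ whose Sidon constant is at most $1+\varepsilon$ and which satisfies $|H|\ge\delta|F|$. -/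

import Mathlib

open MeasureTheory
open scoped ENNReal DirectSum ComplexConjugate

noncomputable section

/-- The compact abelian group `G` dual to the discrete abelian group `Γ` (written
multiplicatively): all homomorphisms from `Γ` to the unit circle, with the compact-open topology
coming from the discrete topology `⊥` of `Γ`, that is, the topology of pointwise convergence.
The elements of `Γ` are the characters of `G`: `γ` sends `x` to `x γ`. -/
abbrev CompactDual (Γ : Type*) [CommGroup Γ] : Type _ := @PontryaginDual Γ _ ⊥

/-- The Borel σ-algebra of the compact dual. -/
instance CompactDual.instMeasurableSpace (Γ : Type*) [CommGroup Γ] :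
    MeasurableSpace (CompactDual Γ) := borel _

instance CompactDual.instBorelSpace (Γ : Type*) [CommGroup Γ] : BorelSpace (CompactDual Γ) := ⟨rfl⟩

/-- The Fourier–Stieltjes transform at `γ` of a complex Borel measure `μ` on the dual `G` of `Γ`,
that is, the integral over `G` of the complex conjugate of the character `γ` against `μ`. -/
def fourierStieltjes {Γ : Type*} [CommGroup Γ] (μ : ComplexMeasure (CompactDual Γ)) (γ : Γ) : ℂ :=
  VectorMeasure.integral μ (fun x : CompactDual Γ => conj ((x γ : Circle) : ℂ))
    (ContinuousLinearMap.mul ℝ ℂ)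

/-- `IsSidonBound E C`: the real number `C ≥ 0` is such that every bounded `φ : E → ℂ` is
interpolated on `E` by the Fourier–Stieltjes transform of a (regular) complex Borel measure `μ`
on `G` whose total variation norm is at most `C` times the sup norm of `φ`. -/
def IsSidonBound {Γ : Type*} [CommGroup Γ] (E : Set Γ) (C : ℝ) : Prop :=
  0 ≤ C ∧ ∀ φ : lp (fun _ : E => ℂ) ∞, ∃ μ : ComplexMeasure (CompactDual Γ),
    μ.variation.Regular ∧ (∀ γ : E, fourierStieltjes μ (γ : Γ) = φ γ) ∧
      μ.variation Set.univ ≤ ENNReal.ofReal (C * ‖φ‖)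

/-- Sidon sets. -/
def IsSidon {Γ : Type*} [CommGroup Γ] (E : Set Γ) : Prop := ∃ C : ℝ, IsSidonBound E C

/-- The Sidon constant of a Sidon set (the value carries no meaning for other sets). -/
def sidonConstant {Γ : Type*} [CommGroup Γ] (E : Set Γ) : ℝ := sInf {C : ℝ | IsSidonBound E C}

end

/-! A Riesz product built from Fejér kernels of degree `n` is a probability measure whose
coefficients on a family satisfying no integral relation with coefficients at most `n + 1` in
absolute value can be prescribed up to the factor `n / (n + 1)`. Such a family therefore has Sidon
constant at most `1 + 1 / n`, and the task is to find one of proportional size inside `F`.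

Since the primes tend to infinity, all but finitely many exceed `n + 1`. Fixing the finitely many
coordinates with small primes costs a constant factor and puts a large part of `F` in a coset of a
finite group `A` of order prime to `1, ..., n + 1`. The Sidon property makes sums of its characters
subgaussian (`IsSidonBound.sum_cosh_le`). Powers `x ^ m` with `m ≤ n + 1` permute the dual of `A`,
so sums over multiples of the frequencies are subgaussian too, which bounds a weighted count of the
relations (`sum_relations_pow_le`).

By this count some colouring with `K` colours leaves no long relation monochromatic. In the largest
colour class, deleting the support of a longest relation destroys all relations at small cost
(`exists_relation_free_of_subgaussian`). If the part of `F` is too small for this argument, a single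
point suffices. -/

noncomputable section

/-! ### Complex measures on the dual group and the duality form of the Sidon property -/

section Measures

variable {Γ : Type*} [CommGroup Γ]

theorem CompactDual.continuous_eval (γ : Γ) :
    Continuous fun x : CompactDual Γ => ((x γ : Circle) : ℂ) := by
  let _ : TopologicalSpace Γ := ⊥
  have h : Continuous fun x : Γ →ₜ* Circle => x γ := continuous_eval_const γ
  exact continuous_subtype_val.comp h

/-- The character of the dual group given by an abstract homomorphism to the circle. -/
def CompactDual.ofHom (f : Γ →* Circle) : CompactDual Γ :=
  letI : TopologicalSpace Γ := ⊥
  (⟨f, continuous_bot⟩ : Γ →ₜ* Circle)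

@[simp]
theorem CompactDual.ofHom_apply (f : Γ →* Circle) (γ : Γ) : CompactDual.ofHom f γ = f γ := rfl

theorem CompactDual.integrable_conj_eval (m : Measure (CompactDual Γ)) [IsFiniteMeasure m] (γ : Γ) :
    Integrable (fun x : CompactDual Γ => conj ((x γ : Circle) : ℂ)) m := by
  refine Integrable.of_bound (C := 1) ?_ (Filter.Eventually.of_forall fun x => by simp [Circle.norm_coe])
  exact (Complex.continuous_conj.comp (CompactDual.continuous_eval γ)).measurable.aestronglyMeasurable

/-- A finite measure concentrated on a finite set is regular. -/
theorem regular_of_compl_finite_eq_zero {X : Type*} [TopologicalSpace X] [T2Space X]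
    [MeasurableSpace X] [BorelSpace X] {m : Measure X} [IsFiniteMeasure m] {Z : Set X}
    (hZ : Z.Finite) (h0 : m Zᶜ = 0) : m.Regular := by
  have : m.InnerRegular := by
    refine ⟨fun U _ r hr => ⟨U ∩ Z, Set.inter_subset_left, (hZ.inter_of_right U).isCompact, ?_⟩⟩
    refine hr.trans_le ?_
    rw [← measure_inter_add_sdiff U hZ.measurableSet]
    have : m (U \ Z) = 0 := measure_mono_null (fun x hx => hx.2) h0
    rw [this, add_zero]
  infer_instance

/-- Finitely supported complex measures have the expected Fourier–Stieltjes transform, and their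
variation is controlled by the sum of the absolute values of the weights. -/
theorem exists_discrete_measure {κ : Type*} [Fintype κ] (z : κ → CompactDual Γ) (c : κ → ℂ) :
    ∃ μ : ComplexMeasure (CompactDual Γ), μ.variation.Regular ∧
      (∀ γ, fourierStieltjes μ γ = ∑ k, conj ((z k γ : Circle) : ℂ) * c k) ∧
      μ.variation Set.univ ≤ ENNReal.ofReal (∑ k, ‖c k‖) := by
  have hle : (∑ k, VectorMeasure.dirac (z k) (c k)).variation ≤
      ∑ k, ‖c k‖ₑ • Measure.dirac (z k) :=
    (VectorMeasure.variation_finsetSum_le _ _).trans (by simp)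
  refine ⟨∑ k, VectorMeasure.dirac (z k) (c k), ?_, fun γ => ?_, ?_⟩
  · have hfin : IsFiniteMeasure (∑ k, VectorMeasure.dirac (z k) (c k)).variation := by
      refine ⟨(hle Set.univ).trans_lt ?_⟩
      simp [Measure.coe_finsetSum]
    have : T2Space (CompactDual Γ) := by
      let _ : TopologicalSpace Γ := ⊥
      infer_instance
    exact regular_of_compl_finite_eq_zero (Set.finite_range z) (by
      refine le_antisymm ((hle _).trans ?_) bot_le
      have hm : MeasurableSet (Set.range z)ᶜ := (Set.finite_range z).measurableSet.compl
      simp [Measure.coe_finsetSum, hm])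
  · rw [fourierStieltjes, VectorMeasure.integral_finsetSum_vectorMeasure]
    · refine Finset.sum_congr rfl fun k _ => ?_
      rw [VectorMeasure.integral_dirac']
      · simp
      · exact (Complex.continuous_conj.comp
          (CompactDual.continuous_eval γ)).measurable.stronglyMeasurable
    · intro k _
      exact CompactDual.integrable_conj_eval _ γ
  · refine (hle Set.univ).trans ?_
    simp only [Measure.coe_finsetSum, Finset.sum_apply, Measure.smul_apply, measure_univ,
      smul_eq_mul, mul_one]
    rw [ENNReal.ofReal_sum_of_nonneg (fun _ _ => norm_nonneg _)]
    simp [ofReal_norm]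

theorem integral_mul_const_mul {X : Type*} [MeasurableSpace X] (μ : ComplexMeasure X) (c : ℂ)
    (f : X → ℂ) :
    VectorMeasure.integral μ (fun x => c * f x) (ContinuousLinearMap.mul ℝ ℂ) =
      c * VectorMeasure.integral μ f (ContinuousLinearMap.mul ℝ ℂ) := by
  rw [VectorMeasure.integral_eq_setToFun, VectorMeasure.integral_eq_setToFun]
  refine setToFun_smul _ (fun d s x => ?_) c f
  simp [transpose_eq_cbmApplyMeasure, mul_assoc]

/-- A Sidon set dominates trigonometric polynomials with twisted coefficients. -/
theorem IsSidonBound.exists_measure {E : Set Γ} {C : ℝ} (hE : IsSidonBound E C)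
    {ι : Type*} [Fintype ι] {w : ι → Γ} (hw : Function.Injective w) (hwE : ∀ i, w i ∈ E)
    (φ : ι → ℂ) (hφ : ∀ i, ‖φ i‖ ≤ 1) :
    ∃ ν : Measure (CompactDual Γ), ν Set.univ ≤ ENNReal.ofReal C ∧ ∀ u : ι → ℂ,
      ‖∑ i, u i * φ i‖ ≤ ∫ y, ‖∑ i, u i * conj ((y (w i) : Circle) : ℂ)‖ ∂ν := by
  classical
  obtain ⟨hC, hE⟩ := hE
  let w' : ι → E := fun i => ⟨w i, hwE i⟩
  have hw' : Function.Injective w' := fun i j h => hw (congrArg Subtype.val h)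
  -- Extension by zero to the rest of `E` keeps the sup norm at most one.
  let ψ : E → ℂ := Function.extend w' φ 0
  have hψb : ∀ e, ‖ψ e‖ ≤ 1 := by
    intro e
    by_cases he : ∃ i, w' i = e
    · obtain ⟨i, rfl⟩ := he
      simpa [ψ, hw'.extend_apply] using hφ i
    · simp [ψ, Function.extend_apply' _ _ _ he]
  have hψm : Memℓp ψ ∞ := memℓp_infty ⟨1, by rintro _ ⟨e, rfl⟩; exact hψb e⟩
  obtain ⟨μ, -, hμ, hvar⟩ := hE ⟨ψ, hψm⟩
  have hvar' : μ.variation Set.univ ≤ ENNReal.ofReal C := by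
    refine hvar.trans (ENNReal.ofReal_le_ofReal ?_)
    have : ‖(⟨ψ, hψm⟩ : lp (fun _ : E => ℂ) ∞)‖ ≤ 1 :=
      lp.norm_le_of_forall_le zero_le_one hψb
    exact mul_le_of_le_one_right hC this
  have hfin : IsFiniteMeasure μ.variation := ⟨hvar'.trans_lt ENNReal.ofReal_lt_top⟩
  refine ⟨μ.variation, hvar', fun u => ?_⟩
  have h1 : ∀ i, φ i = fourierStieltjes μ (w i) := by
    intro i
    have := hμ (w' i)
    simp only [w'] at this
    rw [this]
    exact (hw'.extend_apply φ 0 i).symm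
  have h2 : ∑ i, u i * φ i =
      VectorMeasure.integral μ (fun y => ∑ i, u i * conj ((y (w i) : Circle) : ℂ))
        (ContinuousLinearMap.mul ℝ ℂ) := by
    rw [VectorMeasure.integral_finsetSum]
    · refine Finset.sum_congr rfl fun i _ => ?_
      rw [h1, fourierStieltjes]
      rw [integral_mul_const_mul]
    · intro i _
      exact (CompactDual.integrable_conj_eval μ.variation (w i)).const_mul (u i)
  rw [h2]
  refine VectorMeasure.norm_integral_le_integral_norm.trans ?_
  simp

end Measures

/-! ### Exponential moments of random signed sums -/

section Subgaussian

/-- The exponential of a signed sum factors over the independent signs; `cosh` is the mean of the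
exponentials for `s = 1` and `s = -1`. -/
theorem sum_cosh_sum_sign {ι : Type*} [Fintype ι] [DecidableEq ι] (r : ι → ℝ) :
    ∑ e ∈ Fintype.piFinset (fun _ : ι => ({1, -1} : Finset ℝ)), Real.cosh (∑ i, e i * r i) =
      2 ^ Fintype.card ι * ∏ i, Real.cosh (r i) := by
  have key : ∀ s : ℝ, s = 1 ∨ s = -1 →
      ∑ e ∈ Fintype.piFinset (fun _ : ι => ({1, -1} : Finset ℝ)), Real.exp (s * ∑ i, e i * r i) =
        2 ^ Fintype.card ι * ∏ i, Real.cosh (r i) := by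
    intro s hs
    have h1 : ∀ i, ∑ a ∈ ({1, -1} : Finset ℝ), Real.exp (s * (a * r i)) = 2 * Real.cosh (r i) := by
      intro i
      rw [Finset.sum_pair (by norm_num), Real.cosh_eq]
      rcases hs with rfl | rfl
      · simp; ring
      · simp; ring
    calc _ = ∑ e ∈ Fintype.piFinset (fun _ : ι => ({1, -1} : Finset ℝ)),
          ∏ i, Real.exp (s * (e i * r i)) := by
          refine Finset.sum_congr rfl fun e _ => ?_
          rw [Finset.mul_sum, Real.exp_sum]
      _ = ∏ i, ∑ a ∈ ({1, -1} : Finset ℝ), Real.exp (s * (a * r i)) := by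
          rw [Finset.prod_univ_sum]
      _ = _ := by simp [h1, Finset.prod_mul_distrib]
  simp_rw [Real.cosh_eq (∑ i, _ * r i)]
  rw [← Finset.sum_div, Finset.sum_add_distrib]
  have k1 := key 1 (Or.inl rfl)
  have k2 := key (-1) (Or.inr rfl)
  simp only [one_mul, neg_one_mul] at k1 k2
  rw [k1, k2]
  ring

theorem prod_cosh_le {ι : Type*} [Fintype ι] (r : ι → ℝ) (t : ℝ) (hr : ∀ i, |r i| ≤ t) :
    ∏ i, Real.cosh (r i) ≤ Real.exp (t ^ 2 / 2 * Fintype.card ι) := by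
  calc ∏ i, Real.cosh (r i) ≤ ∏ _i : ι, Real.exp (t ^ 2 / 2) := by
        refine Finset.prod_le_prod (fun i _ => (Real.cosh_pos _).le) fun i _ => ?_
        refine (Real.cosh_le_exp_half_sq _).trans (Real.exp_le_exp.2 ?_)
        have := sq_le_sq' (by linarith [abs_nonneg (r i), hr i, neg_abs_le (r i)])
          ((le_abs_self _).trans (hr i))
        linarith
    _ = _ := by
        rw [Finset.prod_const, ← Real.exp_nat_mul, Finset.card_univ, mul_comm]

/-- The sum on the right equals `2 * cosh (a + b) * cosh (a - b)`, and `cosh (a - b) ≥ 1`. This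
decouples real and imaginary parts at the cost of doubling the parameter. -/
theorem Real.cosh_add_le (a b : ℝ) :
    Real.cosh (a + b) ≤ (Real.cosh (2 * a) + Real.cosh (2 * b)) / 2 := by
  have h : Real.cosh (2 * a) + Real.cosh (2 * b) = 2 * Real.cosh (a + b) * Real.cosh (a - b) := by
    have e1 : 2 * a = (a + b) + (a - b) := by ring
    have e2 : 2 * b = (a + b) - (a - b) := by ring
    rw [e1, e2, Real.cosh_add (a + b) (a - b), Real.cosh_sub (a + b) (a - b)]
    ring
  rw [h]
  nlinarith [Real.one_le_cosh (a - b), Real.cosh_pos (a + b)]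

/-- Random signed sums of complex numbers in the unit disc are subgaussian. -/
theorem sum_cosh_norm_sum_sign_le {ι : Type*} [Fintype ι] [DecidableEq ι] (z : ι → ℂ)
    (hz : ∀ i, ‖z i‖ ≤ 1) {t : ℝ} (ht : 0 ≤ t) :
    ∑ e ∈ Fintype.piFinset (fun _ : ι => ({1, -1} : Finset ℝ)),
        Real.cosh (t * ‖∑ i, (e i : ℂ) * z i‖) ≤
      2 ^ Fintype.card ι * Real.exp (2 * t ^ 2 * Fintype.card ι) := by
  have hpt : ∀ e : ι → ℝ, Real.cosh (t * ‖∑ i, (e i : ℂ) * z i‖) ≤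
      (Real.cosh (∑ i, e i * (2 * t * (z i).re)) + Real.cosh (∑ i, e i * (2 * t * (z i).im))) / 2 := by
    intro e
    set w := ∑ i, (e i : ℂ) * z i
    have hre : ∑ i, e i * (2 * t * (z i).re) = 2 * t * w.re := by
      simp only [w, Complex.re_sum, Finset.mul_sum]
      exact Finset.sum_congr rfl fun i _ => by simp; ring
    have him : ∑ i, e i * (2 * t * (z i).im) = 2 * t * w.im := by
      simp only [w, Complex.im_sum, Finset.mul_sum]
      exact Finset.sum_congr rfl fun i _ => by simp; ring
    rw [hre, him]
    calc Real.cosh (t * ‖w‖) ≤ Real.cosh (t * |w.re| + t * |w.im|) := by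
          rw [Real.cosh_le_cosh, abs_of_nonneg (by positivity), abs_of_nonneg (by positivity),
            ← mul_add]
          exact mul_le_mul_of_nonneg_left (Complex.norm_le_abs_re_add_abs_im w) ht
      _ ≤ _ := by
          refine (Real.cosh_add_le _ _).trans (le_of_eq ?_)
          rw [← Real.cosh_abs (2 * t * w.re), ← Real.cosh_abs (2 * t * w.im)]
          simp only [abs_mul, abs_of_nonneg ht, abs_two, mul_assoc]
  refine (Finset.sum_le_sum fun e _ => hpt e).trans ?_
  rw [← Finset.sum_div, Finset.sum_add_distrib, sum_cosh_sum_sign, sum_cosh_sum_sign]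
  have hb : ∀ r : ι → ℝ, (∀ i, |r i| ≤ 1) → ∏ i, Real.cosh (2 * t * r i) ≤
      Real.exp (2 * t ^ 2 * Fintype.card ι) := by
    intro r hr
    refine (prod_cosh_le (fun i => 2 * t * r i) (2 * t) fun i => ?_).trans (le_of_eq ?_)
    · rw [abs_mul, abs_of_nonneg (by positivity : (0:ℝ) ≤ 2 * t)]
      exact mul_le_of_le_one_right (by positivity) (hr i)
    · congr 1; ring
  have h1 := hb (fun i => (z i).re) fun i => (Complex.abs_re_le_norm _).trans (hz i)
  have h2 := hb (fun i => (z i).im) fun i => (Complex.abs_im_le_norm _).trans (hz i)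
  have h3 : (0:ℝ) < 2 ^ Fintype.card ι := by positivity
  nlinarith [mul_le_mul_of_nonneg_left h1 h3.le, mul_le_mul_of_nonneg_left h2 h3.le]

end Subgaussian

/-! ### Rudin's inequality for Sidon sets -/

section Rudin

variable {Γ : Type*} [CommGroup Γ] {A : Type*} [AddCommGroup A] [Fintype A]

/-- Jensen's inequality for `cosh` and a finite measure of mass at most `C`. -/
theorem cosh_integral_le {X : Type*} [MeasurableSpace X] {m : Measure X} {C : ℝ} (hC : 0 ≤ C)
    (hm : m Set.univ ≤ ENNReal.ofReal C) (hm0 : m ≠ 0) {f : X → ℝ} (hf : Measurable f)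
    (hf0 : ∀ x, 0 ≤ f x) {B : ℝ} (hB : ∀ x, f x ≤ B) :
    Real.cosh (∫ x, f x ∂m) ≤ ⨍ x, Real.cosh (C * f x) ∂m := by
  have hfin : IsFiniteMeasure m := ⟨hm.trans_lt ENNReal.ofReal_lt_top⟩
  have : NeZero m := ⟨hm0⟩
  have hreal : m.real Set.univ ≤ C := ENNReal.toReal_le_of_le_ofReal hC hm
  have hpos : 0 < m.real Set.univ := by simp [measureReal_def, ENNReal.toReal_pos_iff, hm0]
  have hbd : ∀ g : ℝ → ℝ, Continuous g → Integrable (fun x => g (f x)) m := by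
    intro g hg
    obtain ⟨D, hD⟩ := (isCompact_Icc (a := 0) (b := B)).exists_bound_of_continuousOn hg.continuousOn
    exact Integrable.of_bound (hg.measurable.comp hf).aestronglyMeasurable D
      (Filter.Eventually.of_forall fun x => hD _ ⟨hf0 x, hB x⟩)
  have hconv : ConvexOn ℝ Set.univ Real.cosh :=
    convexOn_univ_of_deriv2_nonneg Real.differentiable_cosh (by simp) (by simp [Real.cosh_pos, le_of_lt])
  -- As the mass is at most `C`, the integral is dominated by a mean, to which Jensen applies.
  have h1 : ∫ x, f x ∂m ≤ ⨍ x, C * f x ∂m := by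
    rw [average_eq, smul_eq_mul, integral_const_mul]
    have h0 : 0 ≤ ∫ x, f x ∂m := integral_nonneg hf0
    rw [← mul_assoc, ← div_eq_inv_mul]
    exact le_mul_of_one_le_left h0 ((one_le_div hpos).2 hreal)
  have h0 : 0 ≤ ∫ x, f x ∂m := integral_nonneg hf0
  calc Real.cosh (∫ x, f x ∂m) ≤ Real.cosh (⨍ x, C * f x ∂m) := by
        rw [Real.cosh_le_cosh, abs_of_nonneg h0, abs_of_nonneg (h0.trans h1)]
        exact h1
    _ ≤ _ := hconv.map_average_le Real.continuous_cosh.continuousOn isClosed_univ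
        (by simp) (hbd (fun s => C * s) (by fun_prop))
        (hbd (fun s => Real.cosh (C * s)) (by fun_prop))

/-- **Rudin's inequality** in exponential form: on a coset of a finite subgroup, the sum of the
characters in a finite part of a Sidon set is subgaussian. -/
theorem IsSidonBound.sum_cosh_le {E : Set Γ} {C : ℝ} (hE : IsSidonBound E C)
    {ι : Type*} [Fintype ι] {w : ι → Γ} (hw : Function.Injective w) (hwE : ∀ i, w i ∈ E)
    (inc : A → Γ) (hinc0 : inc 0 = 1) (hinc : ∀ a b, inc (a + b) = inc a * inc b)
    (g : Γ) (v : ι → A) (hv : ∀ i, w i = g * inc (v i)) {t : ℝ} (ht : 0 ≤ t) :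
    ∑ x : AddChar A ℂ, Real.cosh (t * ‖∑ i, x (v i)‖) ≤
      Fintype.card A * Real.exp (2 * t ^ 2 * C ^ 2 * Fintype.card ι) := by
  classical
  -- The conjugate of `y` restricted to `A`: multiplication by it permutes the characters of `A`, so
  -- sums over the dual of `A` do not depend on `y`.
  let res : CompactDual Γ → AddChar A ℂ := fun y =>
    { toFun := fun a => conj ((y (inc a) : Circle) : ℂ)
      map_zero_eq_one' := by simp [hinc0]
      map_add_eq_mul' := fun a b => by simp [hinc] }
  -- A measure interpolating the signs `e`, tested against the coefficients `x (v i) * e i`,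
  -- recovers the unsigned sum because `e i * e i = 1`. Any choice of signs thus dominates, and one
  -- may average over all of them.
  have step : ∀ e ∈ Fintype.piFinset (fun _ : ι => ({1, -1} : Finset ℝ)),
      ∑ x : AddChar A ℂ, Real.cosh (t * ‖∑ i, x (v i)‖) ≤
        ∑ x : AddChar A ℂ, Real.cosh (t * C * ‖∑ i, (e i : ℂ) * x (v i)‖) := by
    intro e he
    have he' : ∀ i, e i = 1 ∨ e i = -1 := fun i => by
      simpa using Fintype.mem_piFinset.1 he i
    obtain ⟨ν, hν, hνe⟩ := hE.exists_measure hw hwE (fun i => (e i : ℂ)) (fun i => by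
      rcases he' i with h | h <;> simp [h])
    have hsq : ∀ i, (e i : ℂ) * e i = 1 := fun i => by rcases he' i with h | h <;> simp [h]
    set S := ∑ x : AddChar A ℂ, Real.cosh (t * C * ‖∑ i, (e i : ℂ) * x (v i)‖) with hS
    have htrans : ∀ y : CompactDual Γ, ∀ x : AddChar A ℂ,
        ‖∑ i, (x (v i) * e i) * conj ((y (w i) : Circle) : ℂ)‖ =
          ‖∑ i, (e i : ℂ) * (x * res y) (v i)‖ := by
      intro y x
      have : ∑ i, (x (v i) * e i) * conj ((y (w i) : Circle) : ℂ) =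
          conj ((y g : Circle) : ℂ) * ∑ i, (e i : ℂ) * (x * res y) (v i) := by
        rw [Finset.mul_sum]
        refine Finset.sum_congr rfl fun i _ => ?_
        simp only [hv, map_mul, Circle.coe_mul, AddChar.mul_apply, res, AddChar.coe_mk]
        ring
      rw [this, norm_mul, RCLike.norm_conj, Circle.norm_coe, one_mul]
    have hpt : ∀ x : AddChar A ℂ, ‖∑ i, x (v i)‖ ≤
        ∫ y, ‖∑ i, (e i : ℂ) * (x * res y) (v i)‖ ∂ν := by
      intro x
      have := hνe fun i => x (v i) * e i
      simp only [mul_assoc, hsq, mul_one] at this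
      refine this.trans (le_of_eq ?_)
      refine integral_congr_ae (Filter.Eventually.of_forall fun y => ?_)
      simpa only [mul_assoc] using htrans y x
    have hmeas : ∀ x : AddChar A ℂ,
        Measurable fun y => ‖∑ i, (e i : ℂ) * (x * res y) (v i)‖ := by
      intro x
      have : Continuous fun y : CompactDual Γ =>
          ‖∑ i, (x (v i) * e i) * conj ((y (w i) : Circle) : ℂ)‖ := by
        refine continuous_norm.comp (continuous_finsetSum _ fun i _ => continuous_const.mul ?_)
        exact Complex.continuous_conj.comp (CompactDual.continuous_eval _)
      simpa only [htrans] using this.measurable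
    have hbound : ∀ (x : AddChar A ℂ) y,
        ‖∑ i, (e i : ℂ) * (x * res y) (v i)‖ ≤ Fintype.card ι := by
      intro x y
      refine (norm_sum_le _ _).trans ?_
      refine (Finset.sum_le_card_nsmul _ _ 1 fun i _ => ?_).trans (by simp)
      rw [norm_mul, AddChar.norm_apply]
      rcases he' i with h | h <;> simp [h]
    -- The zero measure cannot be normalised for Jensen; here all the character sums vanish.
    by_cases hν0 : ν = 0
    · have : ∀ x : AddChar A ℂ, ‖∑ i, x (v i)‖ = 0 := fun x =>
        le_antisymm (by simpa [hν0] using hpt x) (norm_nonneg _)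
      simp only [this, mul_zero, Real.cosh_zero, hS]
      exact Finset.sum_le_sum fun x _ => Real.one_le_cosh _
    have : NeZero ν := ⟨hν0⟩
    have hfin : IsFiniteMeasure ν := ⟨hν.trans_lt ENNReal.ofReal_lt_top⟩
    calc ∑ x : AddChar A ℂ, Real.cosh (t * ‖∑ i, x (v i)‖)
        ≤ ∑ x : AddChar A ℂ, ⨍ y, Real.cosh (C * (t * ‖∑ i, (e i : ℂ) * (x * res y) (v i)‖)) ∂ν := by
          refine Finset.sum_le_sum fun x _ => ?_
          refine le_trans ?_ (cosh_integral_le hE.1 hν hν0 ((hmeas x).const_mul t)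
            (fun y => by positivity) (B := t * Fintype.card ι)
            (fun y => mul_le_mul_of_nonneg_left (hbound x y) ht))
          rw [integral_const_mul, Real.cosh_le_cosh, abs_of_nonneg (by positivity)]
          refine le_trans ?_ (le_abs_self _)
          exact mul_le_mul_of_nonneg_left (hpt x) ht
      _ = ⨍ y, ∑ x : AddChar A ℂ,
            Real.cosh (C * (t * ‖∑ i, (e i : ℂ) * (x * res y) (v i)‖)) ∂ν := by
          simp only [average_eq, smul_eq_mul]
          rw [integral_finsetSum, Finset.mul_sum]
          intro x _
          refine Integrable.of_bound (C := Real.cosh (C * (t * Fintype.card ι))) ?_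
            (Filter.Eventually.of_forall fun y => ?_)
          · exact (Real.continuous_cosh.measurable.comp
              (((hmeas x).const_mul t).const_mul C)).aestronglyMeasurable
          · have hC := hE.1
            rw [Real.norm_of_nonneg (Real.cosh_pos _).le, Real.cosh_le_cosh,
              abs_of_nonneg (by positivity), abs_of_nonneg (by positivity)]
            have := hbound x y
            gcongr
      _ = ⨍ _y, S ∂ν := by
          congr 1
          funext y
          rw [hS]
          refine Fintype.sum_equiv (Equiv.mulRight (res y)) _ _ fun x => ?_
          simp only [Equiv.coe_mulRight]
          congr 1; ring
      _ = S := average_const ν S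
  have hcard : ((Fintype.piFinset (fun _ : ι => ({1, -1} : Finset ℝ))).card : ℝ) =
      2 ^ Fintype.card ι := by
    rw [Fintype.card_piFinset]
    simp [Finset.card_pair (show (1:ℝ) ≠ -1 by norm_num)]
  have hsum := Finset.card_nsmul_le_sum _ _ _ step
  rw [nsmul_eq_mul, hcard, Finset.sum_comm] at hsum
  have hle : ∑ x : AddChar A ℂ, ∑ e ∈ Fintype.piFinset (fun _ : ι => ({1, -1} : Finset ℝ)),
      Real.cosh (t * C * ‖∑ i, (e i : ℂ) * x (v i)‖) ≤
      Fintype.card A * (2 ^ Fintype.card ι * Real.exp (2 * t ^ 2 * C ^ 2 * Fintype.card ι)) := by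
    refine (Finset.sum_le_card_nsmul _ _ _ fun x _ => sum_cosh_norm_sum_sign_le
      (fun i => x (v i)) (fun i => (x.norm_apply _).le)
      (mul_nonneg ht hE.1)).trans (le_of_eq ?_)
    rw [nsmul_eq_mul, Finset.card_univ, AddChar.card_eq]
    congr 3
    ring
  have h2 : (0:ℝ) < 2 ^ Fintype.card ι := by positivity
  have := hsum.trans hle
  rw [mul_left_comm] at this
  exact le_of_mul_le_mul_left this h2

end Rudin

/-! ### Counting relations and extracting a relation-free subfamily -/

section Relations

variable {A : Type*} [AddCommGroup A] {ι : Type*} [Fintype ι]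

/-- The family `v` is independent of degree `M`: it satisfies no non-trivial integral linear
relation with coefficients of absolute value at most `M`. -/
def IsDegreeIndependent (M : ℕ) (v : ι → A) : Prop :=
  ∀ q : ι → ℤ, (∀ i, |q i| ≤ M) → ∑ i, q i • v i = 0 → q = 0

open Classical in
/-- The integral linear relations of degree at most `M` of a finite family. -/
def relations (M : ℕ) (v : ι → A) : Finset (ι → ℤ) :=
  {q ∈ Fintype.piFinset fun _ => Finset.Icc (-(M : ℤ)) M | ∑ i, q i • v i = 0}

theorem mem_relations {M : ℕ} {v : ι → A} {q : ι → ℤ} :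
    q ∈ relations M v ↔ (∀ i, |q i| ≤ M) ∧ ∑ i, q i • v i = 0 := by
  simp [relations, Fintype.mem_piFinset, abs_le]

/-- The support of an integral vector. -/
def coeffSupport (q : ι → ℤ) : Finset ι := {i | q i ≠ 0}

theorem mem_coeffSupport {q : ι → ℤ} {i : ι} : i ∈ coeffSupport q ↔ q i ≠ 0 := by
  simp [coeffSupport]

theorem AddChar.map_sum_eq_prod' (x : AddChar A ℂ) (a : ι → A) : x (∑ i, a i) = ∏ i, x (a i) := by
  have := map_prod x.toMonoidHom (fun i => Multiplicative.ofAdd (a i)) Finset.univ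
  simpa [← ofAdd_sum] using this

/-- The mean of a product of trigonometric polynomials, expanded over the relations between their
frequencies. -/
theorem sum_prod_sum_char [Fintype A] [DecidableEq A] [DecidableEq ι] {σ : Type*} (s : Finset σ)
    (v : ι → A) (β : ι → σ → ℂ) (e : ι → σ → ℤ) :
    ∑ x : AddChar A ℂ, ∏ i, ∑ a ∈ s, β i a * x (e i a • v i) =
      Fintype.card A * ∑ q ∈ Fintype.piFinset (fun _ : ι => s) with ∑ i, e i (q i) • v i = 0,
        ∏ i, β i (q i) := by
  calc ∑ x : AddChar A ℂ, ∏ i, ∑ a ∈ s, β i a * x (e i a • v i)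
      = ∑ x : AddChar A ℂ, ∑ q ∈ Fintype.piFinset (fun _ : ι => s),
          (∏ i, β i (q i)) * x (∑ i, e i (q i) • v i) := by
        refine Finset.sum_congr rfl fun x _ => ?_
        rw [Finset.prod_univ_sum]
        refine Finset.sum_congr rfl fun q _ => ?_
        rw [Finset.prod_mul_distrib, AddChar.map_sum_eq_prod']
    _ = ∑ q ∈ Fintype.piFinset (fun _ : ι => s), (∏ i, β i (q i)) *
          if ∑ i, e i (q i) • v i = 0 then (Fintype.card A : ℂ) else 0 := by
        rw [Finset.sum_comm]
        refine Finset.sum_congr rfl fun q _ => ?_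
        rw [← Finset.mul_sum, AddChar.sum_apply_eq_ite]
    _ = _ := by
        rw [Finset.mul_sum, Finset.sum_filter]
        refine Finset.sum_congr rfl fun q _ => ?_
        split_ifs <;> ring

theorem sum_Icc_neg_natCast {R : Type*} [AddCommMonoid R] (M : ℕ) (f : ℤ → R) :
    ∑ m ∈ Finset.Icc (-(M : ℤ)) M, f m = f 0 + ∑ m ∈ Finset.Icc 1 M, (f m + f (-m)) := by
  induction M with
  | zero => simp
  | succ M ih =>
    have h : Finset.Icc (-((M + 1 : ℕ) : ℤ)) ((M + 1 : ℕ) : ℤ) =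
        insert ((M : ℤ) + 1) (insert (-((M : ℤ) + 1)) (Finset.Icc (-(M : ℤ)) M)) := by
      ext m
      simp only [Finset.mem_insert, Finset.mem_Icc]
      omega
    rw [h, Finset.sum_insert (by simp; omega), Finset.sum_insert (by simp), ih,
      Finset.sum_Icc_succ_top (by omega)]
    push_cast
    abel

/-- If the sums of characters over the powers of a family are subgaussian, then the family has few
relations. -/
theorem sum_relations_pow_le [Fintype A] {M : ℕ} (hM : 1 ≤ M)
    (hA : ∀ m, 1 ≤ m → m ≤ M → (Fintype.card A).Coprime m) (v : ι → A) {C : ℝ}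
    (hv : ∀ t : ℝ, 0 ≤ t → ∑ x : AddChar A ℂ, Real.cosh (t * ‖∑ i, x (v i)‖) ≤
      Fintype.card A * Real.exp (2 * t ^ 2 * C ^ 2 * Fintype.card ι))
    {τ : ℝ} (hτ : 0 ≤ τ) (hτM : τ * (2 * M) ≤ 1) :
    ∑ q ∈ relations M v, τ ^ (coeffSupport q).card ≤
      2 * Real.exp (8 * M ^ 2 * C ^ 2 * τ ^ 2 * Fintype.card ι) := by
  classical
  -- The factor `1 + τ * D x i` has coefficient `1` at frequency `0` and `τ` at the other multiples
  -- of `v i` up to `M`. Averaging the product over `x` keeps exactly the relations, each weighted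
  -- by `τ` to the size of its support.
  set D : AddChar A ℂ → ι → ℝ := fun x i => ∑ m ∈ Finset.Icc 1 M, 2 * ((x ^ m) (v i)).re with hD
  set f : AddChar A ℂ → ℂ := fun x => ∑ i, x (v i) with hf
  have hexp : (Fintype.card A : ℝ) * ∑ q ∈ relations M v, τ ^ (coeffSupport q).card =
      ∑ x : AddChar A ℂ, ∏ i, (1 + τ * D x i) := by
    have h := sum_prod_sum_char (Finset.Icc (-(M : ℤ)) M) v
      (fun _ m => if m = 0 then 1 else (τ : ℂ)) (fun _ m => m)
    have h1 : ∀ q : ι → ℤ, ∏ i, (if q i = 0 then 1 else (τ : ℂ)) = (τ : ℂ) ^ (coeffSupport q).card := by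
      intro q
      rw [Finset.prod_ite]
      simp [coeffSupport]
    have h2 : ∀ (x : AddChar A ℂ) (i : ι), ∑ m ∈ Finset.Icc (-(M : ℤ)) M,
        (if m = 0 then 1 else (τ : ℂ)) * x (m • v i) = ((1 + τ * D x i : ℝ) : ℂ) := by
      intro x i
      rw [sum_Icc_neg_natCast]
      simp only [hD, if_pos, zero_smul, AddChar.map_zero_eq_one, mul_one]
      push_cast
      rw [Finset.mul_sum]
      congr 1
      refine Finset.sum_congr rfl fun m hm => ?_
      have hm0 : (m : ℤ) ≠ 0 := by have := (Finset.mem_Icc.1 hm).1; omega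
      rw [if_neg hm0, if_neg (neg_ne_zero.2 hm0), neg_smul, AddChar.map_neg_eq_conj, ← mul_add,
        Complex.add_conj, natCast_zsmul, AddChar.map_nsmul_eq_pow]
      simp only [Pi.pow_apply]
      push_cast
      rfl
    simp only [h1, h2] at h
    have h3 : ((Fintype.card A : ℝ) * ∑ q ∈ relations M v, τ ^ (coeffSupport q).card : ℝ) =
        ((∑ x : AddChar A ℂ, ∏ i, (1 + τ * D x i) : ℝ) : ℂ) := by
      push_cast at h ⊢
      rw [h, relations]
    exact_mod_cast h3
  have hnn : ∀ x i, 0 ≤ 1 + τ * D x i := by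
    intro x i
    have : -(2 * M : ℝ) ≤ D x i := by
      have : ∀ m ∈ Finset.Icc 1 M, (-2 : ℝ) ≤ 2 * ((x ^ m) (v i)).re := by
        intro m _
        have h := (abs_le.1 (Complex.abs_re_le_norm ((x ^ m) (v i)))).1
        rw [AddChar.norm_apply] at h
        linarith
      have := Finset.card_nsmul_le_sum _ _ _ this
      simp only [Nat.card_Icc, add_tsub_cancel_right, nsmul_eq_mul] at this
      simp only [hD]
      linarith
    nlinarith
  have hM0 : (0 : ℝ) < M := by exact_mod_cast hM
  -- Use `1 + s ≤ exp s`, legitimate in a product because the factors are nonnegative, then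
  -- convexity of `exp` to separate the `M` powers of `x`.
  have hpt : ∀ x, ∏ i, (1 + τ * D x i) ≤
      ∑ m ∈ Finset.Icc 1 M, (M : ℝ)⁻¹ * (2 * Real.cosh (2 * M * τ * ‖f (x ^ m)‖)) := by
    intro x
    calc ∏ i, (1 + τ * D x i) ≤ ∏ i, Real.exp (τ * D x i) :=
          Finset.prod_le_prod (fun i _ => hnn x i) fun i _ => by
            rw [add_comm]; exact Real.add_one_le_exp _
      _ = Real.exp (τ * ∑ i, D x i) := by rw [← Real.exp_sum, Finset.mul_sum]
      _ ≤ Real.exp (∑ m ∈ Finset.Icc 1 M, (M : ℝ)⁻¹ • (2 * M * τ * ‖f (x ^ m)‖)) := by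
          refine Real.exp_le_exp.2 ?_
          rw [Finset.sum_comm, Finset.mul_sum]
          refine Finset.sum_le_sum fun m _ => ?_
          rw [← Finset.mul_sum, ← Complex.re_sum, smul_eq_mul]
          have : (M : ℝ)⁻¹ * (2 * M * τ * ‖f (x ^ m)‖) = τ * (2 * ‖f (x ^ m)‖) := by
            field_simp
          rw [this]
          have := Complex.re_le_norm (f (x ^ m))
          gcongr
      _ ≤ ∑ m ∈ Finset.Icc 1 M, (M : ℝ)⁻¹ • Real.exp (2 * M * τ * ‖f (x ^ m)‖) := by
          refine convexOn_exp.map_sum_le (fun _ _ => by positivity) ?_ (fun _ _ => Set.mem_univ _)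
          simp [hM0.ne']
      _ ≤ _ := by
          refine Finset.sum_le_sum fun m _ => ?_
          rw [smul_eq_mul]
          refine mul_le_mul_of_nonneg_left ?_ (by positivity)
          rw [Real.cosh_eq]
          have := Real.exp_pos (-(2 * M * τ * ‖f (x ^ m)‖))
          linarith
  have hcard : (0 : ℝ) < Fintype.card A := by exact_mod_cast Fintype.card_pos
  refine le_of_mul_le_mul_left ?_ hcard
  rw [hexp]
  refine (Finset.sum_le_sum fun x _ => hpt x).trans ?_
  rw [Finset.sum_comm]
  have hm : ∀ m ∈ Finset.Icc 1 M, ∑ x : AddChar A ℂ,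
      (M : ℝ)⁻¹ * (2 * Real.cosh (2 * M * τ * ‖f (x ^ m)‖)) ≤ (M : ℝ)⁻¹ *
        (2 * (Fintype.card A * Real.exp (8 * M ^ 2 * C ^ 2 * τ ^ 2 * Fintype.card ι))) := by
    intro m hm
    obtain ⟨hm1, hm2⟩ := Finset.mem_Icc.1 hm
    -- Coprimality makes `x ↦ x ^ m` a permutation of the dual, reducing every power to `m = 1`.
    have hco : (Nat.card (AddChar A ℂ)).Coprime m := by
      rw [Nat.card_eq_fintype_card, AddChar.card_eq]
      exact hA m hm1 hm2
    rw [← Finset.mul_sum, ← Finset.mul_sum]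
    refine mul_le_mul_of_nonneg_left (mul_le_mul_of_nonneg_left ?_ zero_le_two) (by positivity)
    have h := Fintype.sum_equiv (powCoprime hco)
      (fun x => Real.cosh (2 * M * τ * ‖f (x ^ m)‖)) (fun x => Real.cosh (2 * M * τ * ‖f x‖))
      (fun x => by simp)
    rw [h]
    refine (hv (2 * M * τ) (by positivity)).trans (le_of_eq ?_)
    congr 2
    ring
  refine (Finset.sum_le_card_nsmul _ _ _ hm).trans (le_of_eq ?_)
  rw [nsmul_eq_mul, Nat.card_Icc, add_tsub_cancel_right]
  field_simp

/-- If a family of finite sets is sparse, then some colouring makes none of them monochromatic. -/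
theorem exists_coloring_of_sum_lt {Q : Type*} (R : Finset Q) (supp : Q → Finset ι) {K : ℕ}
    (hK : 0 < K) (h : K * ∑ q ∈ R, ((K : ℝ)⁻¹) ^ (supp q).card < 1) :
    ∃ f : ι → Fin K, ∀ q ∈ R, ∀ c, ∃ i ∈ supp q, f i ≠ c := by
  classical
  by_contra! hcon
  -- Union bound: the colourings equal to `c` on `supp q` form a proportion `K⁻¹ ^ (supp q).card` of
  -- all colourings.
  let bad : Q → Fin K → Finset (ι → Fin K) := fun q c =>
    Fintype.piFinset fun i => if i ∈ supp q then {c} else Finset.univ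
  have hsub : (Finset.univ : Finset (ι → Fin K)) ⊆ R.biUnion fun q => Finset.univ.biUnion (bad q) := by
    intro f _
    obtain ⟨q, hq, c, hc⟩ := hcon f
    simp only [Finset.mem_biUnion, Finset.mem_univ, true_and]
    refine ⟨q, hq, c, Fintype.mem_piFinset.2 fun i => ?_⟩
    split_ifs with hi
    · simpa using hc i hi
    · simp
  have hK' : (0 : ℝ) < K := by exact_mod_cast hK
  have hbad : ∀ q c, ((bad q c).card : ℝ) = (K : ℝ) ^ Fintype.card ι * (K : ℝ)⁻¹ ^ (supp q).card := by
    intro q c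
    have h1 : (bad q c).card * K ^ (supp q).card = K ^ Fintype.card ι := by
      rw [Fintype.card_piFinset]
      have : ∀ i, (if i ∈ supp q then ({c} : Finset (Fin K)) else Finset.univ).card =
          if i ∈ supp q then 1 else K := fun i => by split_ifs <;> simp
      simp only [this]
      rw [Finset.prod_ite]
      simp only [Finset.prod_const, one_pow, one_mul]
      rw [← pow_add, ← Finset.card_univ]
      congr 1
      rw [← Finset.card_sdiff_add_card_eq_card (Finset.subset_univ (supp q))]
      congr 2
      ext i
      simp
    rw [inv_pow, eq_mul_inv_iff_mul_eq₀ (by positivity)]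
    exact_mod_cast h1
  have hle : (K : ℝ) ^ Fintype.card ι ≤
      ∑ q ∈ R, K * ((K : ℝ) ^ Fintype.card ι * (K : ℝ)⁻¹ ^ (supp q).card) := by
    have h1 := Finset.card_le_card hsub
    have h2 : (R.biUnion fun q => Finset.univ.biUnion (bad q)).card ≤
        ∑ q ∈ R, ∑ c, (bad q c).card :=
      Finset.card_biUnion_le.trans (Finset.sum_le_sum fun q _ => Finset.card_biUnion_le)
    have h3 : (K ^ Fintype.card ι : ℕ) ≤ ∑ q ∈ R, ∑ c, (bad q c).card := by
      simpa using h1.trans h2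
    have h4 : ((K ^ Fintype.card ι : ℕ) : ℝ) ≤ ((∑ q ∈ R, ∑ c, (bad q c).card : ℕ) : ℝ) := by
      exact_mod_cast h3
    push_cast at h4
    simpa [hbad] using h4
  have : ∑ q ∈ R, K * ((K : ℝ) ^ Fintype.card ι * (K : ℝ)⁻¹ ^ (supp q).card) =
      (K : ℝ) ^ Fintype.card ι * (K * ∑ q ∈ R, ((K : ℝ)⁻¹) ^ (supp q).card) := by
    rw [Finset.mul_sum, Finset.mul_sum]
    exact Finset.sum_congr rfl fun q _ => by ring
  rw [this] at hle
  have hp : (0 : ℝ) < (K : ℝ) ^ Fintype.card ι := by positivity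
  nlinarith

/-- If no long relation is supported in `S`, then removing the support of a longest relation in `S`
leaves a set without relations. -/
theorem exists_subset_relation_free (M : ℕ) (v : ι → A) (S : Finset ι) {L : ℝ}
    (hS : ∀ q ∈ relations M v, coeffSupport q ⊆ S → ((coeffSupport q).card : ℝ) < L) :
    ∃ T ⊆ S, (S.card : ℝ) - L ≤ T.card ∧
      ∀ q ∈ relations M v, coeffSupport q ⊆ T → q = 0 := by
  classical
  have h0 : (0 : ι → ℤ) ∈ (relations M v).filter fun q => coeffSupport q ⊆ S := by
    simp [mem_relations, coeffSupport]
  obtain ⟨q, hq, hmax⟩ := Finset.exists_max_image _ (fun q => (coeffSupport q).card) ⟨0, h0⟩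
  rw [Finset.mem_filter] at hq
  refine ⟨S \ coeffSupport q, Finset.sdiff_subset, ?_, fun r hr hrT => ?_⟩
  · have h1 := Finset.card_sdiff_add_card_eq_card hq.2
    have h2 := hS q hq.1 hq.2
    have h3 : ((S \ coeffSupport q).card : ℝ) + (coeffSupport q).card = S.card := by
      exact_mod_cast h1
    linarith
  -- Disjoint supports keep the coefficients of `q + r` bounded by `M`, so a nonzero `r` would give
  -- a relation in `S` longer than `q`.
  · have hdisj : Disjoint (coeffSupport q) (coeffSupport r) :=
      Finset.disjoint_left.2 fun i hi hi' => (Finset.mem_sdiff.1 (hrT hi')).2 hi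
    have hz : ∀ i, q i = 0 ∨ r i = 0 := by
      intro i
      by_contra! h
      exact Finset.disjoint_left.1 hdisj (mem_coeffSupport.2 h.1) (mem_coeffSupport.2 h.2)
    have hsupp : coeffSupport (q + r) = coeffSupport q ∪ coeffSupport r := by
      ext i
      simp only [mem_coeffSupport, Finset.mem_union, Pi.add_apply]
      rcases hz i with h | h <;> simp [h]
    have hqr : q + r ∈ (relations M v).filter fun q => coeffSupport q ⊆ S := by
      rw [Finset.mem_filter, mem_relations, hsupp]
      have hq1 := mem_relations.1 hq.1
      have hr1 := mem_relations.1 hr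
      refine ⟨⟨fun i => ?_, ?_⟩, Finset.union_subset hq.2 (hrT.trans Finset.sdiff_subset)⟩
      · rcases hz i with h | h
        · simpa [h] using hr1.1 i
        · simpa [h] using hq1.1 i
      · simp [add_smul, Finset.sum_add_distrib, hq1.2, hr1.2]
    have := hmax _ hqr
    rw [hsupp, Finset.card_union_of_disjoint hdisj] at this
    have hr0 : coeffSupport r = ∅ := Finset.card_eq_zero.1 (by omega)
    funext i
    by_contra hi
    have : i ∈ coeffSupport r := mem_coeffSupport.2 hi
    simp [hr0] at this

/-- Subgaussian families contain proportional subfamilies that are independent of degree `M`. -/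
theorem exists_relation_free_of_subgaussian [Fintype A] {M : ℕ} (hM : 1 ≤ M)
    (hA : ∀ m, 1 ≤ m → m ≤ M → (Fintype.card A).Coprime m) (v : ι → A) {C : ℝ}
    (hv : ∀ t : ℝ, 0 ≤ t → ∑ x : AddChar A ℂ, Real.cosh (t * ‖∑ i, x (v i)‖) ≤
      Fintype.card A * Real.exp (2 * t ^ 2 * C ^ 2 * Fintype.card ι))
    {K : ℕ} (hK : 4 * M ≤ K) (hKC : 512 * M ^ 2 * C ^ 2 ≤ K)
    (hN : 1024 * K ^ 3 ≤ Fintype.card ι) :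
    ∃ T : Finset ι, (Fintype.card ι : ℝ) / (2 * K) ≤ T.card ∧
      ∀ q ∈ relations M v, coeffSupport q ⊆ T → q = 0 := by
  classical
  have hK0 : 0 < K := by omega
  have hK' : (0 : ℝ) < K := by exact_mod_cast hK0
  have hK1 : (1 : ℝ) ≤ K := by exact_mod_cast hK0
  set N := Fintype.card ι with hNdef
  have hN' : (1024 : ℝ) * K ^ 3 ≤ N := by exact_mod_cast hN
  have hNpos : (0 : ℝ) < N := lt_of_lt_of_le (by positivity) hN'
  set L : ℝ := N / (4 * K) with hL
  have hLpos : 0 < L := by positivity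
  set R := (relations M v).filter fun q => L ≤ (coeffSupport q).card with hR
  -- With `τ` twice the colouring weight `1 / K`, a relation of length at least `L` gains `2 ^ (-L)
  -- ≤ exp (-L / 2) = exp (-N / (8 * K))`. This beats the growth `exp (N / (16 * K))` permitted by
  -- `hKC`.
  have hsum := sum_relations_pow_le hM hA v hv (τ := 2 * (K : ℝ)⁻¹) (by positivity) (by
    have : (4 * M : ℝ) ≤ K := by exact_mod_cast hK
    rw [mul_assoc, mul_comm, mul_assoc, inv_mul_le_one₀] <;> linarith)
  have hcol : K * ∑ q ∈ R, ((K : ℝ)⁻¹) ^ (coeffSupport q).card < 1 := by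
    have h1 : ∀ q ∈ R, ((K : ℝ)⁻¹) ^ (coeffSupport q).card ≤
        Real.exp (-(L / 2)) * (2 * (K : ℝ)⁻¹) ^ (coeffSupport q).card := by
      intro q hq
      have hq2 := (Finset.mem_filter.1 hq).2
      rw [mul_pow, ← mul_assoc]
      refine le_mul_of_one_le_left (by positivity) ?_
      have h2 : Real.exp (L / 2) ≤ 2 ^ (coeffSupport q).card := by
        calc Real.exp (L / 2) ≤ Real.exp ((coeffSupport q).card * Real.log 2) := by
              refine Real.exp_le_exp.2 ?_
              have := Real.log_two_gt_d9
              nlinarith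
          _ = _ := by rw [Real.exp_nat_mul, Real.exp_log two_pos]
      calc (1 : ℝ) = Real.exp (-(L / 2)) * Real.exp (L / 2) := by rw [← Real.exp_add]; simp
        _ ≤ _ := mul_le_mul_of_nonneg_left h2 (Real.exp_pos _).le
    have h2 : ∑ q ∈ R, ((K : ℝ)⁻¹) ^ (coeffSupport q).card ≤ Real.exp (-(L / 2)) *
        (2 * Real.exp (8 * M ^ 2 * C ^ 2 * (2 * (K : ℝ)⁻¹) ^ 2 * N)) := by
      refine (Finset.sum_le_sum h1).trans ?_
      rw [← Finset.mul_sum]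
      refine mul_le_mul_of_nonneg_left (le_trans ?_ hsum) (Real.exp_pos _).le
      exact Finset.sum_le_sum_of_subset_of_nonneg (Finset.filter_subset _ _)
        fun _ _ _ => by positivity
    have h3 : 8 * (M : ℝ) ^ 2 * C ^ 2 * (2 * (K : ℝ)⁻¹) ^ 2 * N ≤ N / (16 * K) := by
      have : 8 * (M : ℝ) ^ 2 * C ^ 2 * (2 * (K : ℝ)⁻¹) ^ 2 * N =
          (512 * M ^ 2 * C ^ 2) * (N / (16 * K ^ 2)) := by
        field_simp; ring
      rw [this]
      calc _ ≤ (K : ℝ) * (N / (16 * K ^ 2)) := by gcongr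
        _ = _ := by field_simp
    have h4 : ∑ q ∈ R, ((K : ℝ)⁻¹) ^ (coeffSupport q).card ≤ 2 * Real.exp (-(N / (16 * K))) := by
      refine h2.trans ?_
      rw [mul_left_comm, ← Real.exp_add]
      refine mul_le_mul_of_nonneg_left (Real.exp_le_exp.2 ?_) zero_le_two
      have : L / 2 = 2 * (N / (16 * K)) := by rw [hL]; field_simp; norm_num
      linarith
    -- The lower bound on `N` pays for the union over `K` colours and the factor `2`.
    have h5 : 2 * (K : ℝ) < Real.exp (N / (16 * K)) := by
      have h6 : (64 : ℝ) * K ^ 2 ≤ N / (16 * K) := by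
        rw [le_div_iff₀ (by positivity)]
        linarith
      have := Real.add_one_le_exp ((N : ℝ) / (16 * K))
      nlinarith
    calc (K : ℝ) * ∑ q ∈ R, ((K : ℝ)⁻¹) ^ (coeffSupport q).card
        ≤ K * (2 * Real.exp (-(N / (16 * K)))) := by gcongr
      _ = (2 * K) * (Real.exp (N / (16 * K)))⁻¹ := by rw [Real.exp_neg]; ring
      _ < 1 := by rw [mul_inv_lt_iff₀ (Real.exp_pos _)]; linarith
  obtain ⟨f, hf⟩ := exists_coloring_of_sum_lt R coeffSupport hK0 hcol
  have : Nonempty (Fin K) := ⟨⟨0, hK0⟩⟩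
  obtain ⟨c, hc⟩ := Fintype.exists_le_card_fiber_of_nsmul_le_card (f := f) (b := (N : ℝ) / K) (by
    simp only [Fintype.card_fin, nsmul_eq_mul]
    rw [mul_div_cancel₀ _ hK'.ne'])
  obtain ⟨T, -, hT, hfree⟩ := exists_subset_relation_free M v
    (Finset.univ.filter fun i => f i = c) (fun q hq hqS => by
      by_contra! hlong
      obtain ⟨i, hi, hne⟩ := hf q (Finset.mem_filter.2 ⟨hq, hlong⟩) c
      exact hne (Finset.mem_filter.1 (hqS hi)).2)
  refine ⟨T, le_trans ?_ hT, hfree⟩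
  have : (N : ℝ) / (2 * K) = N / K - 2 * L := by rw [hL]; field_simp; norm_num
  linarith

end Relations

/-! ### Riesz products of Fejér kernels and interpolation -/

section Riesz

variable {A : Type*} [AddCommGroup A] {ι : Type*} [Fintype ι]

/-- The mean of a product of trigonometric polynomials with independent frequencies is the product
of the means. -/
theorem IsDegreeIndependent.sum_prod_sum_char [Fintype A] {M : ℕ} {v : ι → A}
    (hv : IsDegreeIndependent M v) {σ : Type*} (s : Finset σ) (β : ι → σ → ℂ) (e : ι → σ → ℤ)
    (he : ∀ i, ∀ a ∈ s, |e i a| ≤ M) :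
    ∑ x : AddChar A ℂ, ∏ i, ∑ a ∈ s, β i a * x (e i a • v i) =
      Fintype.card A * ∏ i, ∑ a ∈ s with e i a = 0, β i a := by
  classical
  rw [_root_.sum_prod_sum_char, Finset.prod_univ_sum]
  congr 2
  ext q
  simp only [Finset.mem_filter, Fintype.mem_piFinset]
  constructor
  · rintro ⟨hq, h0⟩
    have := hv (fun i => e i (q i)) (fun i => he i _ (hq i)) h0
    exact fun i => ⟨hq i, congrFun this i⟩
  · intro h
    exact ⟨fun i => (h i).1, by simp [fun i => (h i).2]⟩

/-- With `z = r * u` and `u` unimodular, take `u * (r ± i * √(1 - r ^ 2))`. A rotated Fejér kernel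
only prescribes unimodular values; averaging two reaches the whole disc. -/
theorem Complex.exists_unit_average {z : ℂ} (hz : ‖z‖ ≤ 1) :
    ∃ c d : ℂ, ‖c‖ = 1 ∧ ‖d‖ = 1 ∧ c + d = 2 * z := by
  obtain ⟨u, hu, hzu⟩ : ∃ u : ℂ, ‖u‖ = 1 ∧ z = ‖z‖ * u := by
    by_cases h : z = 0
    · exact ⟨1, by simp, by simp [h]⟩
    · have : ‖z‖ ≠ 0 := norm_ne_zero_iff.2 h
      refine ⟨z / ‖z‖, by simp [this], ?_⟩
      have : (‖z‖ : ℂ) ≠ 0 := by exact_mod_cast this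
      field_simp
  set r := ‖z‖ with hr
  have h0 : 0 ≤ 1 - r ^ 2 := by nlinarith [norm_nonneg z]
  have hn : ∀ s : ℝ, s ^ 2 = 1 - r ^ 2 → ‖(r + s * Complex.I : ℂ)‖ = 1 := by
    intro s hs
    rw [Complex.norm_add_mul_I, hs]
    simp
  refine ⟨u * (r + (√(1 - r ^ 2) : ℝ) * Complex.I), u * (r + (-√(1 - r ^ 2) : ℝ) * Complex.I),
    ?_, ?_, ?_⟩
  · rw [norm_mul, hu, hn _ (Real.sq_sqrt h0), mul_one]
  · rw [norm_mul, hu, hn _ (by rw [neg_sq, Real.sq_sqrt h0]), mul_one]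
  · push_cast
    rw [hzu]
    ring

/-- The coefficients of the average of two rotated Fejér kernels. -/
def fejerCoeff (n : ℕ) (c d : ℂ) (a : ℕ × ℕ) : ℂ :=
  (c ^ a.1 * conj c ^ a.2 + d ^ a.1 * conj d ^ a.2) / (2 * (n + 1))

/-- A pair `(k, l)` carries frequency `k - l`; the `n + 1` diagonal pairs contribute `1 / (n + 1)`
each, so the kernel has mean one. -/
theorem sum_fejerCoeff_zero {n : ℕ} {c d : ℂ} (hc : ‖c‖ = 1) (hd : ‖d‖ = 1) :
    ∑ a ∈ Finset.range (n + 1) ×ˢ Finset.range (n + 1) with (a.1 : ℤ) - a.2 = 0,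
      fejerCoeff n c d a = 1 := by
  have h : ∀ z : ℂ, ‖z‖ = 1 → ∀ k : ℕ, z ^ k * conj z ^ k = 1 := by
    intro z hz k
    rw [← mul_pow, Complex.mul_conj, Complex.normSq_eq_norm_sq, hz]
    simp
  rw [Finset.sum_filter, Finset.sum_product]
  have h1 : ∀ k ∈ Finset.range (n + 1), ∑ l ∈ Finset.range (n + 1),
      (if ((k, l).1 : ℤ) - (k, l).2 = 0 then fejerCoeff n c d (k, l) else 0) = 1 / (n + 1) := by
    intro k hk
    rw [Finset.sum_eq_single k]
    · have : (n + 1 : ℂ) ≠ 0 := by exact_mod_cast n.succ_ne_zero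
      rw [if_pos (by simp), fejerCoeff]
      simp only [h c hc, h d hd]
      field_simp
      norm_num
    · intro l _ hl
      rw [if_neg]
      simp only
      omega
    · exact fun h => absurd hk h
  rw [Finset.sum_congr rfl h1]
  have : (n + 1 : ℂ) ≠ 0 := by exact_mod_cast n.succ_ne_zero
  simp [this]

/-- Only `n` pairs satisfy `k = l + 1`, each contributing `z / (n + 1)`. The missing pair is the
source of the loss `n / (n + 1)`. -/
theorem sum_fejerCoeff_one {n : ℕ} {c d z : ℂ} (hc : ‖c‖ = 1) (hd : ‖d‖ = 1)
    (hz : c + d = 2 * z) :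
    ∑ a ∈ Finset.range (n + 1) ×ˢ Finset.range (n + 1) with (a.1 : ℤ) - a.2 - 1 = 0,
      fejerCoeff n c d a = n / (n + 1) * z := by
  have h : ∀ z : ℂ, ‖z‖ = 1 → ∀ k : ℕ, z ^ (k + 1) * conj z ^ k = z := by
    intro z hz k
    rw [pow_succ, mul_right_comm, ← mul_pow, Complex.mul_conj, Complex.normSq_eq_norm_sq, hz]
    simp
  rw [Finset.sum_filter, Finset.sum_product_right]
  have hn0 : (n + 1 : ℂ) ≠ 0 := by exact_mod_cast n.succ_ne_zero
  have h1 : ∀ l ∈ Finset.range n, ∑ k ∈ Finset.range (n + 1),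
      (if ((k, l).1 : ℤ) - (k, l).2 - 1 = 0 then fejerCoeff n c d (k, l) else 0) = z / (n + 1) := by
    intro l hl
    have hl := Finset.mem_range.1 hl
    rw [Finset.sum_eq_single (l + 1)]
    · rw [if_pos (by simp), fejerCoeff]
      simp only [h c hc, h d hd, hz]
      field_simp
    · intro k _ hk
      rw [if_neg]
      simp only
      omega
    · exact fun h => absurd (Finset.mem_range.2 (by omega)) h
  have h2 : ∑ k ∈ Finset.range (n + 1),
      (if ((k, n).1 : ℤ) - (k, n).2 - 1 = 0 then fejerCoeff n c d (k, n) else 0) = 0 := by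
    refine Finset.sum_eq_zero fun k hk => if_neg ?_
    have := Finset.mem_range.1 hk
    simp only
    omega
  rw [Finset.sum_range_succ, Finset.sum_congr rfl h1, h2]
  simp
  ring

/-- Writing the kernel through squared moduli shows that it is nonnegative. -/
theorem sum_fejerCoeff_mul_char (n : ℕ) (c d : ℂ) (x : AddChar A ℂ) [Finite A] (a : A) :
    ∑ k ∈ Finset.range (n + 1) ×ˢ Finset.range (n + 1),
      fejerCoeff n c d k * x (((k.1 : ℤ) - k.2) • a) =
      (((‖∑ k ∈ Finset.range (n + 1), (c * x a) ^ k‖ ^ 2 +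
        ‖∑ k ∈ Finset.range (n + 1), (d * x a) ^ k‖ ^ 2) / (2 * (n + 1)) : ℝ) : ℂ) := by
  have hx : ∀ k : ℕ × ℕ, x (((k.1 : ℤ) - k.2) • a) = x a ^ k.1 * conj (x a) ^ k.2 := by
    intro k
    rw [sub_smul, sub_eq_add_neg, AddChar.map_add_eq_mul, AddChar.map_neg_eq_conj, natCast_zsmul,
      natCast_zsmul, AddChar.map_nsmul_eq_pow, AddChar.map_nsmul_eq_pow, map_pow]
  have hsq : ∀ c : ℂ, ((‖∑ k ∈ Finset.range (n + 1), (c * x a) ^ k‖ : ℝ) : ℂ) ^ 2 =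
      ∑ k ∈ Finset.range (n + 1) ×ˢ Finset.range (n + 1),
        (c ^ k.1 * conj c ^ k.2) * (x a ^ k.1 * conj (x a) ^ k.2) := by
    intro c
    rw [← Complex.ofReal_pow, ← Complex.normSq_eq_norm_sq, ← Complex.mul_conj, map_sum,
      Finset.sum_mul_sum, ← Finset.sum_product']
    refine Finset.sum_congr rfl fun k _ => ?_
    simp only [map_pow, map_mul, mul_pow]
    ring
  push_cast
  rw [hsq, hsq, ← Finset.sum_add_distrib, Finset.sum_div]
  refine Finset.sum_congr rfl fun k _ => ?_
  rw [hx, fejerCoeff]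
  ring

/-- Riesz products: interpolation by a probability measure on a family of characters that is
independent of degree `n + 1`. -/
theorem IsDegreeIndependent.exists_weights [Fintype A] {n : ℕ} {v : ι → A}
    (hv : IsDegreeIndependent (n + 1) v) (φ : ι → ℂ) (hφ : ∀ i, ‖φ i‖ ≤ 1) :
    ∃ W : AddChar A ℂ → ℝ, (∀ x, 0 ≤ W x) ∧ ∑ x, W x = 1 ∧
      ∀ j, ∑ x, (W x : ℂ) * conj (x (v j)) = n / (n + 1) * φ j := by
  classical
  choose c d hc hd hcd using fun i => Complex.exists_unit_average (hφ i)
  set s := Finset.range (n + 1) ×ˢ Finset.range (n + 1) with hs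
  let κ : AddChar A ℂ → ι → ℝ := fun x i =>
    (‖∑ k ∈ Finset.range (n + 1), (c i * x (v i)) ^ k‖ ^ 2 +
      ‖∑ k ∈ Finset.range (n + 1), (d i * x (v i)) ^ k‖ ^ 2) / (2 * (n + 1))
  have hκ : ∀ x i, (κ x i : ℂ) = ∑ k ∈ s, fejerCoeff n (c i) (d i) k *
      x (((k.1 : ℤ) - k.2) • v i) := fun x i => (sum_fejerCoeff_mul_char _ _ _ _ _).symm
  have hcard : (Fintype.card A : ℂ) ≠ 0 := by exact_mod_cast Fintype.card_ne_zero
  refine ⟨fun x => (Fintype.card A : ℝ)⁻¹ * ∏ i, κ x i, fun x => ?_, ?_, fun j => ?_⟩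
  · refine mul_nonneg (by positivity) (Finset.prod_nonneg fun i _ => ?_)
    simp only [κ]
    positivity
  · have h := hv.sum_prod_sum_char s (fun i => fejerCoeff n (c i) (d i))
      (fun _ k => (k.1 : ℤ) - k.2) (by
        intro i k hk
        simp only [hs, Finset.mem_product, Finset.mem_range] at hk
        rw [abs_le]
        omega)
    simp only [← hκ] at h
    simp only [hs, sum_fejerCoeff_zero (hc _) (hd _), Finset.prod_const_one, mul_one] at h
    have h' : ∑ x : AddChar A ℂ, ∏ i, κ x i = Fintype.card A := by
      exact_mod_cast h
    rw [← Finset.mul_sum, h', inv_mul_cancel₀ (by exact_mod_cast hcard)]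
  -- Pairing with the conjugate of `x (v j)` shifts the `j`-th frequencies from `[-n, n]` to `[-n -
  -- 1, n - 1]`, whence independence of degree `n + 1`.
  · have h := hv.sum_prod_sum_char s (fun i => fejerCoeff n (c i) (d i))
      (fun i k => (k.1 : ℤ) - k.2 - if i = j then 1 else 0) (by
        intro i k hk
        simp only [hs, Finset.mem_product, Finset.mem_range] at hk
        rw [abs_le]
        split_ifs <;> omega)
    have hl : ∀ (x : AddChar A ℂ) i, ∑ k ∈ s, fejerCoeff n (c i) (d i) k *
        x (((k.1 : ℤ) - k.2 - if i = j then 1 else 0) • v i) =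
        κ x i * if i = j then conj (x (v j)) else 1 := by
      intro x i
      rw [hκ, Finset.sum_mul]
      refine Finset.sum_congr rfl fun k _ => ?_
      split_ifs with hij
      · subst hij
        rw [sub_smul _ 1, one_smul, sub_eq_add_neg (_ • v i), AddChar.map_add_eq_mul,
          AddChar.map_neg_eq_conj]
        ring
      · simp
    have hr : ∀ i, ∑ k ∈ s with (k.1 : ℤ) - k.2 - (if i = j then 1 else 0) = 0,
        fejerCoeff n (c i) (d i) k = if i = j then n / (n + 1) * φ j else 1 := by
      intro i
      split_ifs with hij
      · subst hij
        exact sum_fejerCoeff_one (hc i) (hd i) (hcd i)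
      · simpa using sum_fejerCoeff_zero (hc i) (hd i)
    simp only [hl, hr, Finset.prod_mul_distrib, Finset.prod_ite_eq', Finset.mem_univ, if_true] at h
    push_cast
    simp only [mul_assoc]
    rw [← Finset.mul_sum, h, ← mul_assoc, inv_mul_cancel₀ hcard, one_mul]

variable {Γ : Type*} [CommGroup Γ]

/-- A finite family whose image in a finite quotient is independent of degree `n + 1` is a Sidon set
with constant `1 + 1 / n`. -/
theorem IsDegreeIndependent.isSidonBound [Fintype A] {n : ℕ} (hn : n ≠ 0) (π : Γ →* Multiplicative A)
    {w : ι → Γ} (hw : IsDegreeIndependent (n + 1) fun i => (π (w i)).toAdd) :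
    IsSidonBound (Set.range w) (1 + 1 / n) := by
  refine ⟨by positivity, fun φ => ?_⟩
  -- If `φ = 0`, division by zero gives `ψ = 0`, which is still admissible.
  let ψ : ι → ℂ := fun i => φ ⟨w i, i, rfl⟩ / ‖φ‖
  have hφ : ∀ e, ‖φ e‖ ≤ ‖φ‖ := fun e => lp.norm_apply_le_norm (by simp) φ e
  have hψ : ∀ i, ‖ψ i‖ ≤ 1 := fun i => by
    simp only [ψ, norm_div, Complex.norm_real, norm_norm]
    exact div_le_one_of_le₀ (hφ _) (norm_nonneg _)
  have hφψ : ∀ i, φ ⟨w i, i, rfl⟩ = ‖φ‖ * ψ i := by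
    intro i
    by_cases h0 : ‖φ‖ = 0
    · have := hφ ⟨w i, i, rfl⟩
      rw [h0, norm_le_zero_iff] at this
      rw [this, h0]
      simp
    · have : (‖φ‖ : ℂ) ≠ 0 := by exact_mod_cast h0
      simp only [ψ]
      field_simp
  obtain ⟨W, hW0, hW1, hW⟩ := hw.exists_weights ψ hψ
  -- Characters of `A` pulled back along `π` are points of the dual of `Γ`; the factor `1 + 1 / n`
  -- cancels `n / (n + 1)`.
  obtain ⟨μ, hreg, hμ, hvar⟩ := exists_discrete_measure
    (fun x : AddChar A ℂ => CompactDual.ofHom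
      ((AddChar.circleEquivComplex.symm x : AddChar A Circle).toMonoidHom.comp π))
    (fun x => (((1 + 1 / n) * ‖φ‖ * W x : ℝ) : ℂ))
  refine ⟨μ, hreg, ?_, hvar.trans (ENNReal.ofReal_le_ofReal ?_)⟩
  · rintro ⟨_, i, rfl⟩
    rw [hμ, hφψ]
    have hx : ∀ x : AddChar A ℂ, ((CompactDual.ofHom
        ((AddChar.circleEquivComplex.symm x : AddChar A Circle).toMonoidHom.comp π) (w i) :
          Circle) : ℂ) = x (π (w i)).toAdd := by
      intro x
      have := DFunLike.congr_fun (AddChar.circleEquivComplex.apply_symm_apply x) (π (w i)).toAdd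
      exact this
    simp only [hx]
    have hn' : (n : ℂ) ≠ 0 := by exact_mod_cast hn
    have hn1 : (n + 1 : ℂ) ≠ 0 := by exact_mod_cast n.succ_ne_zero
    calc ∑ x : AddChar A ℂ, conj (x (π (w i)).toAdd) * (((1 + 1 / n) * ‖φ‖ * W x : ℝ) : ℂ)
        = (1 + 1 / n) * ‖φ‖ * ∑ x : AddChar A ℂ, (W x : ℂ) * conj (x (π (w i)).toAdd) := by
          rw [Finset.mul_sum]
          refine Finset.sum_congr rfl fun x _ => ?_
          push_cast
          ring
      _ = ‖φ‖ * ψ i := by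
          rw [hW]
          field_simp
  · refine le_of_eq ?_
    have : ∀ x, ‖(((1 + 1 / n) * ‖φ‖ * W x : ℝ) : ℂ)‖ = (1 + 1 / n) * ‖φ‖ * W x := fun x => by
      rw [Complex.norm_real, Real.norm_of_nonneg]
      have := hW0 x
      positivity
    simp only [this, ← Finset.mul_sum, hW1, mul_one]

/-- A set with one element has Sidon constant at most `1`. -/
theorem isSidonBound_singleton (γ : Γ) : IsSidonBound {γ} 1 := by
  refine ⟨zero_le_one, fun φ => ?_⟩
  obtain ⟨μ, hreg, hμ, hvar⟩ := exists_discrete_measure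
    (fun _ : Unit => CompactDual.ofHom (1 : Γ →* Circle)) (fun _ => φ ⟨γ, rfl⟩)
  refine ⟨μ, hreg, ?_, hvar.trans (ENNReal.ofReal_le_ofReal ?_)⟩
  · rintro ⟨_, rfl⟩
    simp [hμ]
  · simpa using lp.norm_apply_le_norm (by simp) φ _

theorem isSidonBound_empty : IsSidonBound (∅ : Set Γ) 1 := by
  refine ⟨zero_le_one, fun φ => ?_⟩
  obtain ⟨μ, hreg, -, hvar⟩ := exists_discrete_measure
    (fun k : Empty => (k.elim : CompactDual Γ)) (fun k => k.elim)
  exact ⟨μ, hreg, fun γ => γ.2.elim, hvar.trans (ENNReal.ofReal_le_ofReal (by simp))⟩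

theorem IsSidonBound.sidonConstant_le {E : Set Γ} {C : ℝ} (h : IsSidonBound E C) :
    sidonConstant E ≤ C :=
  csInf_le ⟨0, fun _ h => h.1⟩ h

end Riesz

/-! ### Reduction to a finite group and choice of constants -/

section Assembly

theorem isDegreeIndependent_restrict {A : Type*} [AddCommGroup A] {ι : Type*} [Fintype ι] {M : ℕ}
    {v : ι → A} {T : Finset ι} (hT : ∀ q ∈ relations M v, coeffSupport q ⊆ T → q = 0) :
    IsDegreeIndependent M fun i : T => v i := by
  classical
  intro q hq h0
  let r : ι → ℤ := fun i => if h : i ∈ T then q ⟨i, h⟩ else 0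
  have hr : ∀ i : T, r i = q i := fun i => by simp [r]
  have hr0 : ∀ i, i ∉ T → r i = 0 := fun i hi => by simp [r, hi]
  have hrel : r ∈ relations M v := by
    refine mem_relations.2 ⟨fun i => ?_, ?_⟩
    · by_cases hi : i ∈ T
      · rw [hr ⟨i, hi⟩]; exact hq _
      · simp [hr0 i hi]
    · rw [← h0, ← Finset.sum_subset (Finset.subset_univ T) fun i _ hi => by simp [hr0 i hi],
        ← Finset.sum_coe_sort T]
      exact Finset.sum_congr rfl fun i _ => by rw [hr]
  have := hT r hrel fun i hi => by
    by_contra h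
    exact mem_coeffSupport.1 hi (hr0 i h)
  funext i
  rw [← hr, this]
  rfl

/-- A large finite part of a Sidon set, contained in a coset of a finite subgroup whose order is
prime to all small integers, has proportional subsets with Sidon constant close to `1`. -/
theorem IsSidonBound.exists_subset_of_coset {Γ : Type*} [CommGroup Γ] {A : Type*} [AddCommGroup A]
    [Fintype A] {E : Set Γ} {C : ℝ} (hE : IsSidonBound E C) {n : ℕ} (hn : n ≠ 0)
    (hA : ∀ m, 1 ≤ m → m ≤ n + 1 → (Fintype.card A).Coprime m)
    (π : Γ →* Multiplicative A) (inc : Multiplicative A →* Γ) (g : Γ)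
    (F : Finset Γ) (hFE : (F : Set Γ) ⊆ E) (hF : ∀ γ ∈ F, γ = g * inc (π γ)) {K : ℕ}
    (hK : 4 * (n + 1) ≤ K) (hKC : 512 * ((n + 1 : ℕ) : ℝ) ^ 2 * C ^ 2 ≤ K)
    (hcard : 1024 * K ^ 3 ≤ F.card) :
    ∃ H ⊆ F, (F.card : ℝ) / (2 * K) ≤ H.card ∧ IsSidonBound (H : Set Γ) (1 + 1 / n) := by
  classical
  have hv := fun t ht => hE.sum_cosh_le (ι := F) (w := Subtype.val) Subtype.val_injective
    (fun i => hFE i.2) (fun a => inc (Multiplicative.ofAdd a)) (by simp) (by simp) g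
    (fun i => (π i).toAdd) (fun i => by simpa using hF i i.2) (t := t) ht
  obtain ⟨T, hT, hfree⟩ := exists_relation_free_of_subgaussian (M := n + 1) (by omega) hA
    (fun i : F => (π i).toAdd) hv hK hKC (by simpa using hcard)
  refine ⟨T.map (Function.Embedding.subtype _), ?_, ?_, ?_⟩
  · intro γ hγ
    obtain ⟨i, -, rfl⟩ := Finset.mem_map.1 hγ
    exact i.2
  · simpa using hT
  · have h := (isDegreeIndependent_restrict hfree).isSidonBound hn π
      (w := fun i : T => ((i : F) : Γ))
    convert h using 1
    ext γ
    simp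

/-- The restriction of an element of a direct sum to finitely many coordinates. -/
def coordProj (p : ℕ → ℕ) (I : Finset ℕ) : (⨁ i : ℕ, ZMod (p i)) →+ (∀ i : I, ZMod (p i)) where
  toFun f i := f i
  map_zero' := rfl
  map_add' _ _ := rfl

theorem mk_coordProj_apply (p : ℕ → ℕ) (I : Finset ℕ) (f : ⨁ i : ℕ, ZMod (p i)) (i : ℕ) :
    DirectSum.mk (fun i => ZMod (p i)) I (coordProj p I f) i = if i ∈ I then f i else 0 := by
  split_ifs with h
  · exact DirectSum.mk_apply_of_mem h
  · exact DirectSum.mk_apply_of_notMem h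

end Assembly

end

theorem proposition4p2 (p : ℕ → ℕ) (hp : ∀ i, (p i).Prime)
    (hlim : Filter.Tendsto p Filter.atTop Filter.atTop)
    (E : Set (Multiplicative (⨁ i : ℕ, ZMod (p i)))) (hE : IsSidon E) :
    ∀ ε : ℝ, 0 < ε → ∃ δ : ℝ, 0 < δ ∧
      ∀ F : Finset (Multiplicative (⨁ i : ℕ, ZMod (p i))),
        (F : Set (Multiplicative (⨁ i : ℕ, ZMod (p i)))) ⊆ E →
        ∃ H : Finset (Multiplicative (⨁ i : ℕ, ZMod (p i))), H ⊆ F ∧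
          IsSidon (H : Set (Multiplicative (⨁ i : ℕ, ZMod (p i)))) ∧
          sidonConstant (H : Set (Multiplicative (⨁ i : ℕ, ZMod (p i)))) ≤ 1 + ε ∧
          δ * (F.card : ℝ) ≤ (H.card : ℝ) := by
  classical
  intro ε hε
  obtain ⟨C, hC⟩ := hE
  have hne : ∀ i, NeZero (p i) := fun i => ⟨(hp i).ne_zero⟩
  obtain ⟨m, hm⟩ := exists_nat_one_div_lt hε
  set n := m + 1 with hn
  have hn1 : 1 + 1 / (n : ℝ) ≤ 1 + ε := by rw [hn]; push_cast; linarith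
  -- From index `N` on, the primes exceed `n + 1`; this is where their divergence enters.
  obtain ⟨N, hN⟩ := Filter.eventually_atTop.1 (hlim.eventually_gt_atTop (n + 1))
  set J := Finset.range N with hJ
  set D : ℕ := Fintype.card (∀ j : J, ZMod (p j)) with hD
  have hD0 : (0 : ℝ) < D := by exact_mod_cast Fintype.card_pos
  obtain ⟨K₀, hK₀⟩ := exists_nat_ge (512 * ((n + 1 : ℕ) : ℝ) ^ 2 * C ^ 2)
  set K := max K₀ (4 * (n + 1)) with hKdef
  have hK : 4 * (n + 1) ≤ K := le_max_right _ _
  have hKC : 512 * ((n + 1 : ℕ) : ℝ) ^ 2 * C ^ 2 ≤ K :=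
    hK₀.trans (by exact_mod_cast le_max_left _ _)
  have hK0 : (1 : ℝ) ≤ K := by exact_mod_cast (by omega : 1 ≤ K)
  have good : ∀ {H : Finset (Multiplicative (⨁ i : ℕ, ZMod (p i)))} {B : ℝ},
      IsSidonBound (H : Set (Multiplicative (⨁ i : ℕ, ZMod (p i)))) B → B ≤ 1 + ε →
      IsSidon (H : Set (Multiplicative (⨁ i : ℕ, ZMod (p i)))) ∧
        sidonConstant (H : Set (Multiplicative (⨁ i : ℕ, ZMod (p i)))) ≤ 1 + ε :=
    fun h hB => ⟨⟨_, h⟩, h.sidonConstant_le.trans hB⟩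
  -- `D` is the pigeonhole loss over the first `N` coordinates. The factor `1024 * K ^ 3` exceeds
  -- the loss `2 * K` for large fibres and is the size below which one point suffices.
  refine ⟨1 / (D * (1024 * K ^ 3)), by positivity, fun F hF => ?_⟩
  obtain ⟨c, -, hc⟩ := Finset.exists_le_card_fiber_of_nsmul_le_card_of_maps_to
    (s := F) (t := Finset.univ) (f := fun γ => coordProj p J γ.toAdd) (b := (F.card : ℝ) / D)
    (fun _ _ => Finset.mem_univ _) Finset.univ_nonempty (by
      rw [Finset.card_univ, nsmul_eq_mul, ← hD, mul_div_cancel₀ _ hD0.ne'])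
  set F' := F.filter fun γ => coordProj p J γ.toAdd = c with hF'
  have hF'F : F' ⊆ F := Finset.filter_subset _ _
  by_cases hlarge : 1024 * K ^ 3 ≤ F'.card
  · have hpos : 0 < F'.card := lt_of_lt_of_le (by positivity) hlarge
    obtain ⟨γ₀, hγ₀⟩ := Finset.card_pos.1 hpos
    set I : Finset ℕ := (F.biUnion fun γ => DFinsupp.support γ.toAdd) \ J with hI
    let π : Multiplicative (⨁ i : ℕ, ZMod (p i)) →* Multiplicative (∀ i : I, ZMod (p i)) :=
      AddMonoidHom.toMultiplicative (coordProj p I)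
    let inc : Multiplicative (∀ i : I, ZMod (p i)) →* Multiplicative (⨁ i : ℕ, ZMod (p i)) :=
      AddMonoidHom.toMultiplicative (DirectSum.mk (fun i => ZMod (p i)) I)
    have hcop : ∀ k, 1 ≤ k → k ≤ n + 1 → (Fintype.card (∀ i : I, ZMod (p i))).Coprime k := by
      intro k hk1 hk2
      rw [Fintype.card_pi]
      refine Nat.Coprime.prod_left fun i _ => ?_
      rw [ZMod.card]
      refine Nat.coprime_of_lt_prime (by omega) (lt_of_le_of_lt hk2 (hN _ ?_)) (hp _)
      have := (Finset.mem_sdiff.1 i.2).2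
      simpa [hJ] using this
    -- Elements of `F'` agree on `J` and vanish outside `I ∪ J`, so they differ only in the
    -- coordinates in `I`.
    have hcoset : ∀ γ ∈ F', γ = γ₀ / inc (π γ₀) * inc (π γ) := by
      intro γ hγ
      apply Multiplicative.toAdd.injective
      refine DFinsupp.ext fun i => ?_
      change γ.toAdd i = (γ₀.toAdd - DirectSum.mk (fun i => ZMod (p i)) I (coordProj p I γ₀.toAdd) +
        DirectSum.mk (fun i => ZMod (p i)) I (coordProj p I γ.toAdd)) i
      rw [DirectSum.add_apply, DirectSum.sub_apply, mk_coordProj_apply, mk_coordProj_apply]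
      split_ifs with hi
      · simp
      · rw [sub_zero, add_zero]
        by_cases hiJ : i ∈ J
        · have h1 := (Finset.mem_filter.1 hγ).2.trans (Finset.mem_filter.1 hγ₀).2.symm
          exact congrFun h1 ⟨i, hiJ⟩
        · have h0 : ∀ η ∈ F', η.toAdd i = 0 := by
            intro η hη
            by_contra h
            exact hi (Finset.mem_sdiff.2 ⟨Finset.mem_biUnion.2
              ⟨η, hF'F hη, (DFinsupp.mem_support_toFun _ _).2 h⟩, hiJ⟩)
          rw [h0 γ hγ, h0 γ₀ hγ₀]
    obtain ⟨H, hHF, hHc, hHS⟩ := hC.exists_subset_of_coset (by omega : n ≠ 0) hcop π inc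
      (γ₀ / inc (π γ₀)) F' (fun γ hγ => hF (hF'F hγ)) hcoset hK hKC hlarge
    obtain ⟨h1, h2⟩ := good hHS hn1
    refine ⟨H, hHF.trans hF'F, h1, h2, le_trans ?_ hHc⟩
    calc 1 / (D * (1024 * K ^ 3)) * (F.card : ℝ) = (F.card : ℝ) / D / (1024 * K ^ 3) := by
          field_simp
      _ ≤ (F.card : ℝ) / D / (2 * K) := by
          have : (2 : ℝ) * K ≤ 1024 * K ^ 3 := by nlinarith [mul_self_nonneg ((K : ℝ) - 1)]
          gcongr
      _ ≤ _ := by gcongr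
  · push Not at hlarge
    rcases F.eq_empty_or_nonempty with rfl | ⟨γ, hγ⟩
    · obtain ⟨h1, h2⟩ := good (H := ∅) (by simpa using isSidonBound_empty) (by linarith)
      exact ⟨∅, Finset.Subset.refl _, h1, h2, by simp⟩
    · obtain ⟨h1, h2⟩ := good (H := {γ}) (by simpa using isSidonBound_singleton γ) (by linarith)
      refine ⟨{γ}, by simpa using hγ, h1, h2, ?_⟩
      have h3 : (F'.card : ℝ) ≤ 1024 * K ^ 3 := by exact_mod_cast hlarge.le
      have h4 : (F.card : ℝ) ≤ D * (1024 * K ^ 3) := by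
        have := (div_le_iff₀ hD0).1 (hc.trans h3)
        linarith
      rw [Finset.card_singleton, Nat.cast_one, one_div, inv_mul_le_one₀ (by positivity)]
      exact h4
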